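/- Let $k$ and $\ell$ be positive integers. An edge coloring of a complete graph is called $k$-Gallai if every induced subgraph on at least two vertices has a partition of its vertex set into at least two nonempty parts such that at most $k$ colors appear on the edges between different parts. For a finite simple graph $H$, let $\mathrm{ggr}_{k,\ell}(H)$ be the minimum $N$ such that, for every $n \ge N$, every $k$-Gallai coloring of the edges of $K_n$ using at most $\ell$ colors contains a monochromatic copy of $H$. Then $\mathrm{ggr}_{k,\ell}(H)$ exists (is finite) for all $k,\ell\ge 1$ and every finite graph $H$, and the following hold. 1. If $H$ is bipartite and is not a star (where a graph all of whose edges share a common vertex, possibly with additional isolated vertices or without any edges, also counts as a star), then $\mathrm{ggr}_{k,\ell}(H)$ grows linearly in $\ell$: there is a constant $a = a(H) > 0$ and, for every $k \ge 1$, a constant $A = A(k,H)$ such that $$a\,\ell \;\le\; \mathrm{ggr}_{k,\ell}(H) \;\le\; A\,\ell \qquad\text{for all } \ell \ge 1 .$$ 2. If $H$ is not bipartite, then $\mathrm{ggr}_{k,\ell}(H)$ grows exponentially in $\ell$, with a base that grows with the chromatic number $\chi(H)$: there are numbers $B(k,\chi)$, depending only on $k$ and $\chi$, such that for every non-bipartite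 $H$ and every $k \ge 1$ there is a constant $A = A(k,H)$ with $$(\chi(H)-1)^{\ell} \;<\; \mathrm{ggr}_{k,\ell}(H) \;\le\; A\cdot B(k,\chi(H))^{\ell} \qquad\text{for all } \ell \ge 1 .$$ -/

import Mathlib

namespace GallaiRamsey

open SimpleGraph

/-- The set of colors appearing on edges between different parts of a partition `P` of the vertex
set `S`, in an edge coloring `c` of the complete graph on `V`. -/
def colorsBetween {V K : Type*} [DecidableEq V] (c : TopEdgeLabeling V K) {S : Finset V}
    (P : Finpartition S) : Set K :=
  {a | ∃ A ∈ P.parts, ∃ B ∈ P.parts, A ≠ B ∧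
    ∃ x ∈ A, ∃ y ∈ B, (c.labelGraph a).Adj x y}

/-- A coloring of the edges of a complete graph is `k`-Gallai if every induced subgraph on at
least two vertices has a partition of its vertices into at least two (nonempty) parts such that
at most `k` colors appear on the edges between the parts. -/
def IsKGallai {V K : Type*} [DecidableEq V] (k : ℕ) (c : TopEdgeLabeling V K) : Prop :=
  ∀ S : Finset V, 2 ≤ S.card →
    ∃ P : Finpartition S, 2 ≤ P.parts.card ∧ (colorsBetween c P).encard ≤ k

/-- `Forces k ℓ H N`: for every `n ≥ N`, every `k`-Gallai coloring of `K_n` with (at most) `ℓ`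
colors contains a monochromatic copy of `H` (as a not necessarily induced subgraph). -/
def Forces {V : Type*} (k ℓ : ℕ) (H : SimpleGraph V) (N : ℕ) : Prop :=
  ∀ n, N ≤ n → ∀ c : TopEdgeLabeling (Fin n) (Fin ℓ), IsKGallai k c →
    ∃ a : Fin ℓ, H.IsContained (c.labelGraph a)

/-- The generalized `(k, ℓ)` Gallai-Ramsey number of `H`. (`sInf ∅ = 0`: the theorem asserts
separately that the set is nonempty.) -/
noncomputable def ggr {V : Type*} (k ℓ : ℕ) (H : SimpleGraph V) : ℕ :=
  sInf {N | Forces k ℓ H N}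

/-- `H` is a star up to isolated vertices: all of its edges share a vertex (this includes graphs
without edges). -/
def IsStar {V : Type*} (H : SimpleGraph V) : Prop :=
  H = ⊥ ∨ ∃ v : V, ∀ x y : V, H.Adj x y → x = v ∨ y = v

end GallaiRamsey

/-! Lower bounds: give the vertices distinct words of length `ℓ` and color an edge by the first
coordinate where its ends differ. Splitting at the first nonconstant coordinate shows that this is
Gallai. All words over `χ - 1` letters make every color class `(χ - 1)`-colorable; the `ℓ` unit
vectors make every color class a star.

Upper bounds: `exists_balanced_seeing_few_colors` splits any vertex set into `W` and its complement,
each at least a third, so that outside vertices see at most `k` colors in `W`. By pigeonhole, many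
of them have a proportion `1 / k` of `W` as neighbors in one common color (`exists_popular_color`).
For bipartite `H`, one such step yields a large monochromatic complete bipartite graph, and the
pigeonhole over colors costs only a factor `ℓ`. In general the step is iterated: each round
lengthens the tower of one color and shrinks the set of remaining vertices by a factor of at most `6
* k`. A tower of length `towerLength k r` contains a complete `r`-partite graph
(`hasParts_of_joined`), so there are at most `ℓ * towerLength k r` rounds. -/

namespace GallaiRamsey

open SimpleGraph

/-! ### Lower bounds from first-difference colorings. -/

section LowerBounds

variable {V K : Type*}

/-- A coloring in which every vertex set on at least two vertices has a cut all of whose edges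
share one color is `k`-Gallai for every positive `k`. -/
theorem isKGallai_of_exists_monochromatic_cut [DecidableEq V] {k : ℕ} (hk : 1 ≤ k) (c : TopEdgeLabeling V K)
    (h : ∀ S : Finset V, 2 ≤ S.card → ∃ T ⊂ S, T.Nonempty ∧ ∃ a : K,
      ∀ x ∈ T, ∀ y ∈ S \ T, ∀ b, (c.labelGraph b).Adj x y → b = a) : IsKGallai k c := by
  intro S hS
  obtain ⟨T, hTS, hT, a, ha⟩ := h S hS
  have hne : T ≠ ⊥ := hT.ne_empty
  -- Extending the one-part partition of `T` to `S` adds the part `S \ T`.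
  refine ⟨(Finpartition.indiscrete hne).extendOfLE hTS.subset, ?_, ?_⟩
  · rw [Finpartition.parts_extendOfLE_of_lt _ hTS, Finset.card_insert_of_notMem]
    · simp
    · simp only [Finpartition.indiscrete_parts, Finset.mem_singleton]
      intro h
      obtain ⟨x, hx⟩ := hT
      have := h ▸ hx
      simp [hx] at this
  · refine (Set.encard_le_encard (t := {a}) ?_).trans (by simpa using hk)
    rintro b ⟨A, hA, B, hB, hAB, x, hx, y, hy, hb⟩
    rw [Finpartition.parts_extendOfLE_of_lt _ hTS] at hA hB
    simp only [Finpartition.indiscrete_parts, Finset.mem_insert, Finset.mem_singleton] at hA hB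
    rcases hA with rfl | rfl <;> rcases hB with rfl | rfl
    · exact absurd rfl hAB
    · exact ha y hy x hx b hb.symm
    · exact ha x hx y hy b hb
    · exact absurd rfl hAB

variable {ℓ : ℕ} {β : Type*} [DecidableEq β]

theorem differences_nonempty {e : V → Fin ℓ → β} (he : Function.Injective e) {x y : V}
    (h : x ≠ y) : (Finset.univ.filter fun i ↦ e x i ≠ e y i).Nonempty := by
  obtain ⟨i, hi⟩ := Function.ne_iff.1 (he.ne h)
  exact ⟨i, by simpa using hi⟩

/-- Color an edge by the first coordinate in which the words attached to its ends differ. -/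
def firstDifference (e : V → Fin ℓ → β) (he : Function.Injective e) :
    TopEdgeLabeling V (Fin ℓ) :=
  EdgeLabeling.mk
    (fun x y h ↦ (Finset.univ.filter fun i ↦ e x i ≠ e y i).min'
      (differences_nonempty he ((top_adj x y).1 h)))
    (fun x y h ↦ by simp only [ne_comm])

theorem firstDifference_adj {e : V → Fin ℓ → β} {he : Function.Injective e} {a : Fin ℓ} {x y : V}
    (h : ((firstDifference e he).labelGraph a).Adj x y) :
    e x a ≠ e y a ∧ ∀ i < a, e x i = e y i := by
  obtain ⟨hxy, h⟩ := (TopEdgeLabeling.labelGraph_adj x y).1 h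
  rw [firstDifference, EdgeLabeling.get_mk] at h
  constructor
  · have := Finset.min'_mem _ (differences_nonempty he hxy)
    rw [h] at this
    simpa using this
  · intro i hi
    by_contra hne
    have := Finset.min'_le (Finset.univ.filter fun i ↦ e x i ≠ e y i) i (by simpa using hne)
    rw [h] at this
    exact absurd hi this.not_gt

theorem firstDifference_isKGallai [DecidableEq V] {k : ℕ} (hk : 1 ≤ k) (e : V → Fin ℓ → β)
    (he : Function.Injective e) : IsKGallai k (firstDifference e he) := by
  refine isKGallai_of_exists_monochromatic_cut hk _ fun S hS ↦ ?_
  obtain ⟨u, hu, v, hv, huv⟩ := Finset.one_lt_card.1 hS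
  let I := Finset.univ.filter fun i ↦ ∃ x ∈ S, ∃ y ∈ S, e x i ≠ e y i
  have hI : I.Nonempty := by
    obtain ⟨i, hi⟩ := Function.ne_iff.1 (he.ne huv)
    exact ⟨i, by simpa [I] using ⟨u, hu, v, hv, hi⟩⟩
  have hmin : ∀ i < I.min' hI, ∀ x ∈ S, ∀ y ∈ S, e x i = e y i := by
    intro i hi x hx y hy
    by_contra hne
    exact absurd hi (I.min'_le i (by simpa [I] using ⟨x, hx, y, hy, hne⟩)).not_gt
  have hmem := I.min'_mem hI
  generalize I.min' hI = a at hmin hmem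
  obtain ⟨x, hx, y, hy, hxy⟩ : ∃ x ∈ S, ∃ y ∈ S, e x a ≠ e y a := by simpa [I] using hmem
  refine ⟨S.filter fun z ↦ e z a = e x a, Finset.filter_ssubset.2 ⟨y, hy, hxy.symm⟩,
    ⟨x, by simp [hx]⟩, a, ?_⟩
  intro z hz w hw b hb
  simp only [Finset.mem_filter, Finset.mem_sdiff, not_and] at hz hw
  obtain ⟨h1, h2⟩ := firstDifference_adj hb
  have h3 : e z a ≠ e w a := fun h ↦ hw.2 hw.1 (h ▸ hz.2)
  rcases lt_trichotomy a b with h | h | h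
  · exact absurd (h2 a h) h3
  · exact h.symm
  · exact absurd (hmin b h z hz.1 w hw.1) h1

theorem lt_ggr {W : Type*} {H : SimpleGraph W} {k ℓ n : ℕ} (hex : ∃ N, Forces k ℓ H N)
    (c : TopEdgeLabeling (Fin n) (Fin ℓ)) (hc : IsKGallai k c)
    (hH : ∀ a, ¬ H.IsContained (c.labelGraph a)) : n < ggr k ℓ H := by
  by_contra! h
  obtain ⟨a, ha⟩ := (Nat.sInf_mem (s := {N | Forces k ℓ H N}) hex) n h c hc
  exact hH a ha

/-- On the `p ^ ℓ` words over `p` letters, the `a`-th letter properly colors the graph of color `a`,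
hence any copy of `H` in it. -/
theorem pow_lt_ggr {W : Type*} {H : SimpleGraph W} {k ℓ p : ℕ} (hk : 1 ≤ k)
    (hH : ¬ H.Colorable p) (hex : ∃ N, Forces k ℓ H N) : p ^ ℓ < ggr k ℓ H := by
  refine lt_ggr hex _ (firstDifference_isKGallai hk finFunctionFinEquiv.symm
    (finFunctionFinEquiv.symm.injective)) fun a ⟨f⟩ ↦ hH ⟨Coloring.mk
      (fun v ↦ finFunctionFinEquiv.symm (f v) a) fun {v w} hvw ↦ ?_⟩
  exact (firstDifference_adj (f.toHom.map_adj hvw)).1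

/-- Vertex `i` gets the `i`-th unit vector; two of these differ at coordinate `a` only if one of
them is the `a`-th, so color `a` is a star centered at `a`. -/
theorem lt_ggr_of_not_isStar {W : Type*} {H : SimpleGraph W} {k ℓ : ℕ} (hk : 1 ≤ k)
    (hH : ¬ IsStar H) (hex : ∃ N, Forces k ℓ H N) : ℓ < ggr k ℓ H := by
  have he : Function.Injective fun i j : Fin ℓ ↦ decide (i = j) := by
    intro i j h
    have := congrFun h j
    simpa using this
  refine lt_ggr hex _ (firstDifference_isKGallai hk _ he) fun a ⟨f⟩ ↦ hH ?_
  have key : ∀ v w, H.Adj v w → f v = a ∨ f w = a := by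
    intro v w hvw
    have := (firstDifference_adj (f.toHom.map_adj hvw)).1
    by_contra! hne
    exact this ((decide_eq_false hne.1).trans (decide_eq_false hne.2).symm)
  by_cases hv : ∃ v, f v = a
  · obtain ⟨v, hv⟩ := hv
    exact Or.inr ⟨v, fun x y hxy ↦ (key x y hxy).imp (fun h ↦ f.injective (h.trans hv.symm))
      fun h ↦ f.injective (h.trans hv.symm)⟩
  · refine Or.inl (eq_bot_iff.2 fun x y hxy ↦ ?_)
    exact absurd ((key x y hxy).elim (fun h ↦ ⟨x, h⟩) fun h ↦ ⟨y, h⟩) hv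

end LowerBounds

/-! ### Complete multipartite subgraphs and how towers force them. -/

section Parts

variable {V : Type*}

open scoped Classical in
/-- The neighbors of `v` in `S`. -/
noncomputable def nbrs (G : SimpleGraph V) (S : Finset V) (v : V) : Finset V :=
  S.filter (G.Adj v)

@[simp]
theorem mem_nbrs {G : SimpleGraph V} {S : Finset V} {v w : V} :
    w ∈ nbrs G S v ↔ w ∈ S ∧ G.Adj v w := by
  simp [nbrs]

theorem nbrs_subset (G : SimpleGraph V) (S : Finset V) (v : V) : nbrs G S v ⊆ S :=
  fun _ h ↦ (mem_nbrs.1 h).1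

/-- `G` contains a complete `r`-partite graph with parts of size at least `t` inside `U`. -/
def HasParts (G : SimpleGraph V) (r t : ℕ) (U : Finset V) : Prop :=
  ∃ S : Fin r → Finset V, (∀ i, t ≤ (S i).card) ∧ (∀ i, S i ⊆ U) ∧
    ∀ i j, i ≠ j → ∀ x ∈ S i, ∀ y ∈ S j, G.Adj x y

theorem HasParts.cons {G : SimpleGraph V} {r t : ℕ} {U U' Z : Finset V} (h : HasParts G r t U)
    (hZ : t ≤ Z.card) (hZU : Z ⊆ U') (hU : U ⊆ U') (hadj : ∀ z ∈ Z, ∀ u ∈ U, G.Adj z u) :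
    HasParts G (r + 1) t U' := by
  obtain ⟨S, h1, h2, h3⟩ := h
  refine ⟨Fin.cons Z S, Fin.cases hZ h1, Fin.cases hZU fun i ↦ (h2 i).trans hU, ?_⟩
  intro i j
  refine Fin.cases ?_ (fun i ↦ ?_) i <;> refine Fin.cases ?_ (fun j ↦ ?_) j
  · simp
  · exact fun _ x hx y hy ↦ hadj x hx y (h2 j hy)
  · exact fun _ x hx y hy ↦ (hadj y hy x (h2 i hx)).symm
  · exact fun hij x hx y hy ↦ h3 i j (fun h ↦ hij (h ▸ rfl)) x hx y hy

theorem HasParts.isContained {G : SimpleGraph V} {r t : ℕ} {U : Finset V} (h : HasParts G r t U)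
    {W : Type*} [Finite W] {H : SimpleGraph W} (hH : H.Colorable r) (ht : Nat.card W ≤ t) :
    H.IsContained G := by
  obtain ⟨S, h1, -, h3⟩ := h
  obtain ⟨C⟩ := hH
  have := Fintype.ofFinite W
  have hemb : ∀ i, Nonempty (W ↪ S i) := fun i ↦ by
    rw [Function.Embedding.nonempty_iff_card_le, Fintype.card_coe, ← Nat.card_eq_fintype_card]
    exact ht.trans (h1 i)
  let f := fun i ↦ (hemb i).some
  have hadj : ∀ v w, C v ≠ C w → G.Adj (f (C v) v) (f (C w) w) := fun v w hvw ↦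
    h3 _ _ hvw _ (f (C v) v).2 _ (f (C w) w).2
  refine ⟨⟨⟨fun v ↦ f (C v) v, fun {v w} hvw ↦ hadj v w (C.valid hvw)⟩, fun v w hvw ↦ ?_⟩⟩
  have hvw' : (f (C v) v : V) = f (C w) w := hvw
  by_cases h : C v = C w
  · rw [h] at hvw'
    exact (f (C w)).injective (Subtype.ext hvw')
  · exact absurd hvw' (hadj v w h).ne

/-- If every `a ∈ A` is related to a proportion `1 / k` of `B`, then a proportion `1 / (2 k)` of `B`
is related to a proportion `1 / (2 k)` of `A`. -/
theorem card_le_of_forall_card_le {α β : Type*} (R : α → β → Prop) [∀ a b, Decidable (R a b)]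
    (A : Finset α) (B : Finset β) {k : ℕ} (hk : 1 ≤ k)
    (h : ∀ a ∈ A, B.card ≤ k * (B.filter (R a)).card) :
    B.card ≤ 2 * k *
      (B.filter fun b ↦ A.card ≤ 2 * k * (A.filter fun a ↦ R a b).card).card := by
  rcases A.eq_empty_or_nonempty with rfl | hA
  · simpa using Nat.le_mul_of_pos_left _ (by omega)
  set good := B.filter fun b ↦ A.card ≤ 2 * k * (A.filter fun a ↦ R a b).card with hgood
  have hcount : ∑ a ∈ A, (B.filter (R a)).card = ∑ b ∈ B, (A.filter fun a ↦ R a b).card :=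
    Finset.sum_card_bipartiteAbove_eq_sum_card_bipartiteBelow R
  have h1 : A.card * B.card ≤ k * ∑ a ∈ A, (B.filter (R a)).card := by
    rw [Finset.mul_sum, ← smul_eq_mul]
    exact Finset.card_nsmul_le_sum _ _ _ h
  -- The number of related pairs times `2 * k` is at least `2 * A.card * B.card`; the `b` outside
  -- `good` account for at most half of this.
  have h2 : ∀ b ∈ B, 2 * k * (A.filter fun a ↦ R a b).card ≤
      A.card + (if A.card ≤ 2 * k * (A.filter fun a ↦ R a b).card then 2 * k * A.card else 0) := by
    intro b hb
    split_ifs with hg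
    · exact (Nat.mul_le_mul_left _ (Finset.card_filter_le _ _)).trans (Nat.le_add_left _ _)
    · omega
  have h3 := Finset.sum_le_sum h2
  rw [← Finset.mul_sum, Finset.sum_add_distrib, Finset.sum_const, ← Finset.sum_filter,
    Finset.sum_const, ← hgood, ← hcount, smul_eq_mul, smul_eq_mul] at h3
  have h4 : A.card * B.card ≤ A.card * (2 * k * good.card) := by nlinarith
  exact Nat.le_of_mul_le_mul_left h4 hA.card_pos

/-- The number of sets in a tower which forces a complete `r`-partite graph. -/
def towerLength (k : ℕ) : ℕ → ℕ
  | 0 => 1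
  | r + 1 => 4 * k * towerLength k r + 1

theorem towerLength_pos (k r : ℕ) : 0 < towerLength k r := by
  cases r <;> simp [towerLength]

/-- A proportion `1 / (2 k)` of `X` is completely joined to `X'`. -/
def Joined (G : SimpleGraph V) (k : ℕ) (X X' : Finset V) : Prop :=
  ∃ T ⊆ X, X.card ≤ 2 * k * T.card ∧ ∀ z ∈ T, ∀ x ∈ X', G.Adj z x

/-- Induction on `r`. By double counting, many vertices of the first set are completely joined to at
least `q` of `4 * k * q` later sets. Pigeonhole over the subfamilies gives `t` vertices with the
same subfamily; they form one part, and the other parts come from that subfamily. -/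
theorem hasParts_of_joined [DecidableEq V] (G : SimpleGraph V) {k t D : ℕ} (hk : 1 ≤ k)
    (X : ℕ → Finset V) (r : ℕ) : ∀ I : Finset ℕ, towerLength k r ≤ I.card →
    4 * k * (2 ^ towerLength k r * t) ≤ D → (∀ i ∈ I, (X i).card = D) →
    (∀ i ∈ I, ∀ j ∈ I, i < j → Joined G k (X i) (X j)) → HasParts G r t (I.biUnion X) := by
  induction r with
  | zero =>
    intro I _ _ _ _
    exact ⟨fun i ↦ i.elim0, fun i ↦ i.elim0, fun i ↦ i.elim0, fun i ↦ i.elim0⟩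
  | succ r ih =>
    intro I hI hD hX hJ
    have hq := towerLength_pos k r
    set q := towerLength k r with hqdef
    have hlen : towerLength k (r + 1) = 4 * k * q + 1 := rfl
    rw [hlen] at hI hD
    have hIne : I.Nonempty := Finset.card_pos.1 (by omega)
    set m := I.min' hIne with hm
    have hmI : m ∈ I := I.min'_mem _
    obtain ⟨J, hJI, hJcard⟩ : ∃ J ⊆ I.erase m, J.card = 4 * k * q :=
      Finset.exists_subset_card_eq (by rw [Finset.card_erase_of_mem hmI]; omega)
    have hJmem : ∀ j ∈ J, j ∈ I := fun j hj ↦ Finset.mem_of_mem_erase (hJI hj)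
    have hlt : ∀ j ∈ J, m < j := fun j hj ↦
      lt_of_le_of_ne (I.min'_le j (hJmem j hj)) (Finset.ne_of_mem_erase (hJI hj)).symm
    have hjoin : ∀ j ∈ J, Joined G k (X m) (X j) := fun j hj ↦
      hJ m hmI j (hJmem j hj) (hlt j hj)
    let R : ℕ → V → Prop := fun j z ↦ ∀ x ∈ X j, G.Adj z x
    classical
    have hpop := card_le_of_forall_card_le R J (X m) (k := 2 * k) (by omega) fun j hj ↦ by
      obtain ⟨T, hTX, hT, hadj⟩ := hjoin j hj
      refine hT.trans (Nat.mul_le_mul_left _ (Finset.card_le_card fun z hz ↦ ?_))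
      exact Finset.mem_filter.2 ⟨hTX hz, hadj z hz⟩
    rw [hX m hmI, hJcard] at hpop
    set Z := (X m).filter fun z ↦ 4 * k * q ≤ 2 * (2 * k) * (J.filter fun j ↦ R j z).card with hZ
    have hZcard : 2 ^ (4 * k * q) * t ≤ Z.card := by
      have h1 : 2 ^ (4 * k * q) * t ≤ 2 ^ (4 * k * q + 1) * t :=
        Nat.mul_le_mul_right _ (Nat.pow_le_pow_right (by norm_num) (by omega))
      have h2 : 4 * k * (2 ^ (4 * k * q + 1) * t) ≤ 4 * k * Z.card := by
        refine hD.trans (hpop.trans (le_of_eq (by ring)))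
      exact h1.trans (Nat.le_of_mul_le_mul_left h2 (by omega))
    obtain ⟨I', hI', hfib⟩ := Finset.exists_le_card_fiber_of_mul_le_card_of_maps_to
      (s := Z) (t := J.powerset) (f := fun z ↦ J.filter fun j ↦ R j z) (n := t)
      (fun z _ ↦ Finset.mem_powerset.2 (Finset.filter_subset _ _)) ⟨∅, by simp⟩
      (by rwa [Finset.card_powerset, hJcard])
    set F := Z.filter fun z ↦ (J.filter fun j ↦ R j z) = I' with hF
    have hI'J : I' ⊆ J := Finset.mem_powerset.1 hI'
    have hsub : I' ⊆ I := fun j hj ↦ hJmem j (hI'J hj)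
    -- A vertex of `F` is needed to bound `I'.card` from below; `F` can be empty only for `t = 0`,
    -- where empty parts suffice.
    rcases F.eq_empty_or_nonempty with hFe | ⟨z₀, hz₀⟩
    · have ht : t = 0 := by simpa [hFe] using hfib
      exact ⟨fun _ ↦ ∅, by simp [ht], by simp, by simp⟩
    have hI'card : q ≤ I'.card := by
      obtain ⟨h1, h2⟩ := Finset.mem_filter.1 hz₀
      have h3 := (Finset.mem_filter.1 h1).2
      rw [h2] at h3
      have h4 : 4 * k * q ≤ 4 * k * I'.card := h3.trans (le_of_eq (by ring))
      exact Nat.le_of_mul_le_mul_left h4 (by omega)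
    have hqle : q ≤ 4 * k * q + 1 := by nlinarith
    have hrec := ih I' hI'card (le_trans (Nat.mul_le_mul_left _ (Nat.mul_le_mul_right _
      (Nat.pow_le_pow_right (by norm_num) hqle))) hD) (fun i hi ↦ hX i (hsub hi))
      fun i hi j hj ↦ hJ i (hsub hi) j (hsub hj)
    refine hrec.cons (Z := F) hfib ?_ (Finset.biUnion_subset_biUnion_of_subset_left _ hsub) ?_
    · intro z hz
      exact Finset.mem_biUnion.2 ⟨m, hmI,
        (Finset.mem_filter.1 (Finset.mem_filter.1 hz).1).1⟩
    · intro z hz u hu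
      obtain ⟨j, hj, huj⟩ := Finset.mem_biUnion.1 hu
      have := (Finset.mem_filter.1 hz).2
      rw [← this] at hj
      exact (Finset.mem_filter.1 hj).2 u huj

end Parts

/-! ### Upper bounds: popular colors, the bipartite case, growing towers. -/

section UpperBounds

variable {V : Type*}

/-- The property `Good` passes from a set to any union of parts of its Gallai partition. In a
smallest good set with at least two thirds of `U`, every part has less than two thirds, so some
union of parts has between one and two thirds. -/
theorem exists_balanced_seeing_few_colors {K : Type*} [DecidableEq V] {k : ℕ}
    (c : TopEdgeLabeling V K) (hc : IsKGallai k c) (U : Finset V) (hU : 2 ≤ U.card) :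
    ∃ W ⊆ U, U.card ≤ 3 * W.card ∧ U.card ≤ 3 * (U \ W).card ∧
      ∀ v ∈ U \ W, {a | ∃ w ∈ W, (c.labelGraph a).Adj v w}.encard ≤ k := by
  classical
  let Good : Finset V → Prop := fun W ↦
    ∀ v ∈ U \ W, {a | ∃ w ∈ W, (c.labelGraph a).Adj v w}.encard ≤ k
  obtain ⟨W₀, hW₀, hmin⟩ := Finset.exists_min_image
    (U.powerset.filter fun W ↦ Good W ∧ 2 * U.card ≤ 3 * W.card) Finset.card
    ⟨U, Finset.mem_filter.2 ⟨Finset.mem_powerset_self U, fun v hv ↦ by simp at hv, by omega⟩⟩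
  simp only [Finset.mem_filter, Finset.mem_powerset] at hW₀ hmin
  obtain ⟨hW₀U, hgood₀, hcard₀⟩ := hW₀
  obtain ⟨P, hP, hcol⟩ := hc W₀ (by omega)
  have hgood : ∀ Q ⊆ P.parts, Good (Q.biUnion id) := by
    intro Q hQ v hv
    obtain ⟨hvU, hvQ⟩ := Finset.mem_sdiff.1 hv
    by_cases hv₀ : v ∈ W₀
    · refine (Set.encard_le_encard ?_).trans hcol
      rintro a ⟨w, hw, hvw⟩
      obtain ⟨A, hA, hwA⟩ := Finset.mem_biUnion.1 hw
      obtain ⟨B, hB, hvB⟩ := P.exists_mem hv₀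
      refine ⟨B, hB, A, hQ hA, ?_, v, hvB, w, hwA, hvw⟩
      rintro rfl
      exact hvQ (Finset.mem_biUnion.2 ⟨B, hA, hvB⟩)
    · refine (Set.encard_le_encard ?_).trans (hgood₀ v (Finset.mem_sdiff.2 ⟨hvU, hv₀⟩))
      rintro a ⟨w, hw, hvw⟩
      obtain ⟨A, hA, hwA⟩ := Finset.mem_biUnion.1 hw
      exact ⟨w, P.le (hQ hA) hwA, hvw⟩
  have hpart : ∀ A ∈ P.parts, 3 * A.card < 2 * U.card := by
    intro A hA
    by_contra! hcard
    have hgA : Good A := by simpa using hgood {A} (by simpa using hA)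
    have hle := hmin A ⟨(P.le hA).trans hW₀U, hgA, hcard⟩
    have hAW : A = W₀ := Finset.eq_of_subset_of_card_le (P.le hA) hle
    obtain ⟨B, hB, hBA⟩ := Finset.exists_mem_ne (by omega : 1 < P.parts.card) A
    have hdis : Disjoint B A := P.disjoint hB hA hBA
    exact P.ne_bot hB (hdis.eq_bot_of_le (hAW ▸ P.le hB))
  suffices h : ∃ Q ⊆ P.parts, U.card ≤ 3 * (Q.biUnion id).card ∧
      3 * (Q.biUnion id).card ≤ 2 * U.card by
    obtain ⟨Q, hQ, h1, h2⟩ := h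
    have hsub : Q.biUnion id ⊆ U := Finset.biUnion_subset.2 fun A hA ↦ (P.le (hQ hA)).trans hW₀U
    refine ⟨Q.biUnion id, hsub, h1, ?_, hgood Q hQ⟩
    have := Finset.card_sdiff_add_card_eq_card hsub
    omega
  by_cases hbig : ∃ A ∈ P.parts, U.card ≤ 3 * A.card
  · obtain ⟨A, hA, hAU⟩ := hbig
    exact ⟨{A}, by simpa using hA, by simpa using hAU, by simpa using (hpart A hA).le⟩
  push Not at hbig
  have hall : P.parts.biUnion id = W₀ := P.biUnion_parts
  -- All parts are now below a third, so a minimal family whose union reaches a third stays below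
  -- two thirds.
  obtain ⟨Q, hQ, hQmin⟩ := Finset.exists_min_image
    (P.parts.powerset.filter fun Q ↦ U.card ≤ 3 * (Q.biUnion id).card) Finset.card
    ⟨P.parts, Finset.mem_filter.2 ⟨Finset.mem_powerset_self _, by rw [hall]; omega⟩⟩
  simp only [Finset.mem_filter, Finset.mem_powerset] at hQ hQmin
  refine ⟨Q, hQ.1, hQ.2, ?_⟩
  obtain ⟨A, hA⟩ : Q.Nonempty := by
    rw [Finset.nonempty_iff_ne_empty]
    rintro rfl
    have := hQ.2
    simp at this
    simp [this] at hU
  have h1 := hbig A (hQ.1 hA)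
  have h2 : 3 * ((Q.erase A).biUnion id).card < U.card := by
    by_contra! h
    exact absurd (hQmin _ ⟨(Finset.erase_subset _ _).trans hQ.1, h⟩)
      (Finset.card_erase_lt_of_mem hA).not_ge
  have h3 : (Q.biUnion id).card ≤ A.card + ((Q.erase A).biUnion id).card := by
    conv_lhs => rw [← Finset.insert_erase hA, Finset.biUnion_insert]
    exact Finset.card_union_le _ _
  omega

theorem exists_card_le_mul_card_nbrs [DecidableEq V] {ℓ k : ℕ} (hk : 1 ≤ k)
    (c : TopEdgeLabeling V (Fin ℓ)) {W : Finset V} (hW : W.Nonempty) {v : V} (hv : v ∉ W)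
    (h : {a | ∃ w ∈ W, (c.labelGraph a).Adj v w}.encard ≤ k) :
    ∃ a, W.card ≤ k * (nbrs (c.labelGraph a) W v).card := by
  classical
  by_contra! hlt
  set C := Finset.univ.filter fun a ↦ ∃ w ∈ W, (c.labelGraph a).Adj v w with hC
  have hCk : C.card ≤ k := by
    rw [← Nat.cast_le (α := ℕ∞), ← Set.encard_coe_eq_coe_finsetCard]
    simpa [hC] using h
  have hcover : W ⊆ C.biUnion fun a ↦ nbrs (c.labelGraph a) W v := by
    intro w hw
    have hvw : v ≠ w := fun h ↦ hv (h ▸ hw)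
    have hadj : (c.labelGraph (c.get v w hvw)).Adj v w :=
      (TopEdgeLabeling.labelGraph_adj v w).2 ⟨hvw, rfl⟩
    exact Finset.mem_biUnion.2 ⟨c.get v w hvw,
      Finset.mem_filter.2 ⟨Finset.mem_univ _, w, hw, hadj⟩,
      mem_nbrs.2 ⟨hw, hadj⟩⟩
  have h1 := (Finset.card_le_card hcover).trans (Finset.card_biUnion_le_card_mul C _
    ((W.card - 1) / k) fun a _ ↦ (Nat.le_div_iff_mul_le (by omega)).2 (by
      have := hlt a
      rw [mul_comm]
      omega))
  have h2 := Nat.mul_le_mul_right ((W.card - 1) / k) hCk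
  have h3 := Nat.mul_div_le (W.card - 1) k
  have := hW.card_pos
  omega

/-- In a `k`-Gallai coloring, many vertices share a color in which they have many neighbors in one
large set. -/
theorem exists_popular_color [DecidableEq V] {ℓ k : ℕ} (hk : 1 ≤ k)
    (c : TopEdgeLabeling V (Fin ℓ)) (hc : IsKGallai k c) {U : Finset V} {n : ℕ}
    (hU : 2 ≤ U.card) (hn : 3 * (ℓ * n) ≤ U.card) :
    ∃ a, ∃ X ⊆ U, n ≤ X.card ∧ ∃ W ⊆ U, U.card ≤ 3 * W.card ∧
      ∀ x ∈ X, W.card ≤ k * (nbrs (c.labelGraph a) W x).card := by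
  obtain ⟨W, hWU, hW, hX, hfew⟩ := exists_balanced_seeing_few_colors c hc U hU
  have hWne : W.Nonempty := Finset.card_pos.1 (by omega)
  have hmaj : ∀ v : ↥(U \ W), ∃ a, W.card ≤ k * (nbrs (c.labelGraph a) W v).card := fun v ↦
    exists_card_le_mul_card_nbrs hk c hWne (Finset.mem_sdiff.1 v.2).2 (hfew v v.2)
  choose f hf using hmaj
  obtain ⟨x, hx⟩ : (U \ W).Nonempty := Finset.card_pos.1 (by omega)
  obtain ⟨a, -, ha⟩ := Finset.exists_le_card_fiber_of_mul_le_card_of_maps_to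
    (s := (U \ W).attach) (t := Finset.univ) (f := f) (n := n) (fun _ _ ↦ Finset.mem_univ _)
    ⟨f ⟨x, hx⟩, Finset.mem_univ _⟩ (by
      rw [Finset.card_univ, Fintype.card_fin, Finset.card_attach]
      omega)
  refine ⟨a, ((U \ W).attach.filter fun x ↦ f x = a).map (Function.Embedding.subtype _), ?_,
    by rwa [Finset.card_map], W, hWU, hW, ?_⟩
  · intro y hy
    obtain ⟨z, -, rfl⟩ := Finset.mem_map.1 hy
    exact (Finset.mem_sdiff.1 z.2).1
  · intro y hy
    obtain ⟨z, hz, rfl⟩ := Finset.mem_map.1 hy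
    rw [← (Finset.mem_filter.1 hz).2]
    exact hf z

theorem exists_subset_card_le_mul_card_nbrs (G : SimpleGraph V) {A B : Finset V} {k : ℕ}
    (hk : 1 ≤ k) (h : ∀ a ∈ A, B.card ≤ k * (nbrs G B a).card) :
    ∃ B' ⊆ B, B.card ≤ 2 * k * B'.card ∧ ∀ b ∈ B', A.card ≤ 2 * k * (nbrs G A b).card := by
  classical
  have hsymm : ∀ b, (A.filter fun a ↦ G.Adj a b) = nbrs G A b := fun b ↦ by
    ext a
    simp [G.adj_comm]
  refine ⟨_, Finset.filter_subset _ _, card_le_of_forall_card_le (fun a b ↦ G.Adj a b) A B hk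
    fun a ha ↦ (h a ha).trans (le_of_eq ?_), fun b hb ↦ ?_⟩
  · congr 2
  · rw [← hsymm]
    exact (Finset.mem_filter.1 hb).2

/-- Among many vertices, many have the same neighbors in a small set. -/
theorem exists_same_nbrs (G : SimpleGraph V) {X Z : Finset V} {M n : ℕ} (hZ : Z.card ≤ M)
    (hX : 2 ^ M * n ≤ X.card) : ∃ F ⊆ X, F.card = n ∧ ∃ P, ∀ x ∈ F, nbrs G Z x = P := by
  classical
  obtain ⟨P, -, hP⟩ := Finset.exists_le_card_fiber_of_mul_le_card_of_maps_to
    (s := X) (t := Z.powerset) (f := fun x ↦ nbrs G Z x) (n := n)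
    (fun x _ ↦ Finset.mem_powerset.2 (nbrs_subset G Z x)) ⟨∅, by simp⟩
    (le_trans (Nat.mul_le_mul_right _ (by
      rw [Finset.card_powerset]
      exact Nat.pow_le_pow_right (by norm_num) hZ)) hX)
  obtain ⟨F, hF, hcard⟩ := Finset.exists_subset_card_eq hP
  exact ⟨F, hF.trans (Finset.filter_subset _ _), hcard, P, fun x hx ↦
    (Finset.mem_filter.1 (hF hx)).2⟩

/-- With `D = 2 * k * t` vertices in `A`, a vertex adjacent to a proportion `1 / (2 * k)` of `A` has
`t` neighbors there; pigeonhole over the `2 ^ D` subsets of `A` gives `t` vertices sharing them. -/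
theorem exists_hasParts_two [DecidableEq V] [Fintype V] {ℓ k t : ℕ} (hk : 1 ≤ k) (hℓ : 1 ≤ ℓ)
    (ht : 1 ≤ t) (c : TopEdgeLabeling V (Fin ℓ)) (hc : IsKGallai k c)
    (hV : 6 * k * (2 ^ (2 * k * t) * (2 * k * t)) * ℓ ≤ Fintype.card V) :
    ∃ a U, HasParts (c.labelGraph a) 2 t U := by
  set D := 2 * k * t with hD
  have htD : t ≤ D := Nat.le_mul_of_pos_left _ (by omega)
  have hpow : 1 ≤ 2 ^ D := Nat.one_le_two_pow
  have h1 : D ≤ 2 ^ D * D := Nat.le_mul_of_pos_left _ (by omega)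
  have h2 : 6 * (2 ^ D * D) ≤ 6 * k * (2 ^ D * D) := by nlinarith
  have h3 : 6 * k * (2 ^ D * D) ≤ Fintype.card V :=
    (Nat.le_mul_of_pos_right _ (by omega)).trans hV
  have h4 : 3 * (ℓ * D) ≤ Fintype.card V := by nlinarith
  rw [← Finset.card_univ] at h3 h4
  obtain ⟨a, X, -, hX, W, -, hW, hadj⟩ := exists_popular_color hk c hc (by omega) h4
  obtain ⟨A, hAX, hA⟩ := Finset.exists_subset_card_eq hX
  obtain ⟨B, -, hB, hpop⟩ := exists_subset_card_le_mul_card_nbrs (c.labelGraph a) hk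
    fun x hx ↦ hadj x (hAX hx)
  have h5 : 2 ^ D * t ≤ B.card := by
    have h6 : 2 ^ D * t ≤ 2 ^ D * D := Nat.mul_le_mul_left _ htD
    have h7 : 6 * k * (2 ^ D * D) ≤ 6 * k * B.card := by nlinarith
    exact h6.trans (Nat.le_of_mul_le_mul_left h7 (by omega))
  obtain ⟨F, hFB, hF, P, hP⟩ := exists_same_nbrs (c.labelGraph a) hA.le h5
  obtain ⟨x, hx⟩ : F.Nonempty := Finset.card_pos.1 (by omega)
  have hPt : t ≤ P.card := by
    have := hpop x (hFB hx)
    rw [hA, hP x hx, hD] at this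
    exact Nat.le_of_mul_le_mul_left this (by omega)
  have h0 : HasParts (c.labelGraph a) 0 t ∅ :=
    ⟨fun i ↦ i.elim0, fun i ↦ i.elim0, fun i ↦ i.elim0, fun i ↦ i.elim0⟩
  refine ⟨a, Finset.univ, (h0.cons (U' := F) hF.ge subset_rfl (by simp) (by simp)).cons (Z := P)
    hPt (by simp) (by simp) fun z hz u hu ↦ ?_⟩
  rw [← hP u hu] at hz
  exact (mem_nbrs.1 hz).2.symm

/-- A sequence of sets of size `D`, each with many vertices joined to all later sets, such that all
vertices of `Y` have many neighbors in each of the sets. -/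
structure IsTower (G : SimpleGraph V) (k D m : ℕ) (X : ℕ → Finset V) (Y : Finset V) : Prop where
  card_eq : ∀ i < m, (X i).card = D
  joined : ∀ j < m, ∀ i < j, Joined G k (X i) (X j)
  popular : ∀ i < m, ∀ y ∈ Y, D ≤ 2 * k * (nbrs G (X i) y).card

theorem IsTower.mono {G : SimpleGraph V} {k D m : ℕ} {X : ℕ → Finset V} {Y Y' : Finset V}
    (h : IsTower G k D m X Y) (hY : Y' ⊆ Y) : IsTower G k D m X Y' :=
  ⟨h.card_eq, h.joined, fun i hi y hy ↦ h.popular i hi y (hY hy)⟩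

/-- Since all of `F` has the same neighbors in the earlier sets, the neighbors of one vertex in `X
i`, numerous by `popular`, are joined to all of `F`. -/
theorem IsTower.snoc [DecidableEq V] {G : SimpleGraph V} {k D m : ℕ} {X : ℕ → Finset V}
    {Y Y' F P : Finset V} (h : IsTower G k D m X Y) (hD : 1 ≤ D) (hY : Y' ⊆ Y) (hF : F.card = D)
    (hFY : F ⊆ Y) (hP : ∀ x ∈ F, nbrs G ((Finset.range m).biUnion X) x = P)
    (hpop : ∀ y ∈ Y', D ≤ 2 * k * (nbrs G F y).card) :
    IsTower G k D (m + 1) (Function.update X m F) Y' := by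
  refine ⟨fun i hi ↦ ?_, fun j hj i hij ↦ ?_, fun i hi y hy ↦ ?_⟩
  · rcases Nat.lt_succ_iff_lt_or_eq.1 hi with hi | rfl
    · simpa [hi.ne] using h.card_eq i hi
    · simpa using hF
  · rcases Nat.lt_succ_iff_lt_or_eq.1 hj with hj | rfl
    · simpa [hj.ne, (hij.trans hj).ne] using h.joined j hj i hij
    · rw [Function.update_of_ne hij.ne, Function.update_self]
      obtain ⟨x₀, hx₀⟩ : F.Nonempty := Finset.card_pos.1 (by omega)
      refine ⟨nbrs G (X i) x₀, nbrs_subset _ _ _, ?_, fun z hz x hx ↦ ?_⟩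
      · rw [h.card_eq i hij]
        exact h.popular i hij x₀ (hFY hx₀)
      · obtain ⟨hzX, hzx⟩ := mem_nbrs.1 hz
        have hmem : z ∈ nbrs G ((Finset.range j).biUnion X) x₀ :=
          mem_nbrs.2 ⟨Finset.mem_biUnion.2 ⟨i, Finset.mem_range.2 hij, hzX⟩, hzx⟩
        rw [hP x₀ hx₀, ← hP x hx] at hmem
        exact (mem_nbrs.1 hmem).2.symm
  · rcases Nat.lt_succ_iff_lt_or_eq.1 hi with hi | rfl
    · simpa [hi.ne] using h.popular i hi y (hY hy)
    · simpa using hpop y hy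

theorem IsTower.lt_towerLength [DecidableEq V] {G : SimpleGraph V} {k D m r t : ℕ}
    {X : ℕ → Finset V} {Y : Finset V} (h : IsTower G k D m X Y) (hk : 1 ≤ k)
    (hD : 4 * k * (2 ^ towerLength k r * t) ≤ D) (hno : ∀ U, ¬ HasParts G r t U) :
    m < towerLength k r := by
  by_contra! hm
  refine hno _ (hasParts_of_joined G hk X r (Finset.range m) (by simpa using hm) hD ?_ ?_)
  · exact fun i hi ↦ h.card_eq i (Finset.mem_range.1 hi)
  · exact fun i _ j hj hij ↦ h.joined j (Finset.mem_range.1 hj) i hij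

/-- The tower of a popular color `a` gains a set `F`, and the new reservoir `Y'` consists of
vertices of `W` with many neighbors in `F`. The factor `6 * k` is 3 for passing to `W` times `2 * k`
for passing to `Y'`; the factor `2 ^ (q * D)` pays for equal neighborhoods in the old tower. -/
theorem exists_tower_extension [DecidableEq V] {ℓ k r t D : ℕ} (hk : 1 ≤ k) (hℓ : 1 ≤ ℓ)
    (hD₁ : 1 ≤ D) (hD : 4 * k * (2 ^ towerLength k r * t) ≤ D)
    (c : TopEdgeLabeling V (Fin ℓ)) (hc : IsKGallai k c)
    (hno : ∀ a U, ¬ HasParts (c.labelGraph a) r t U) {m : Fin ℓ → ℕ} {X : Fin ℓ → ℕ → Finset V}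
    {Y : Finset V} (h : ∀ a, IsTower (c.labelGraph a) k D (m a) (X a) Y)
    (hY : 3 * (ℓ * (2 ^ (towerLength k r * D) * D)) ≤ Y.card) :
    ∃ (m' : Fin ℓ → ℕ) (X' : Fin ℓ → ℕ → Finset V) (Y' : Finset V),
      (∀ a, IsTower (c.labelGraph a) k D (m' a) (X' a) Y') ∧
      ∑ a, (towerLength k r - m' a) < ∑ a, (towerLength k r - m a) ∧
      Y.card ≤ 6 * k * Y'.card := by
  have hm : ∀ a, m a < towerLength k r := fun a ↦ (h a).lt_towerLength hk hD (hno a)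
  set q := towerLength k r
  have h1 : 1 ≤ ℓ * (2 ^ (q * D) * D) :=
    Nat.mul_pos hℓ (Nat.mul_pos (by positivity) hD₁)
  obtain ⟨a, A, hAY, hA, W, hWY, hW, hadj⟩ := exists_popular_color hk c hc (by omega) hY
  have hZ : ((Finset.range (m a)).biUnion (X a)).card ≤ q * D := by
    refine (Finset.card_biUnion_le_card_mul _ _ D fun i hi ↦
      ((h a).card_eq i (Finset.mem_range.1 hi)).le).trans ?_
    rw [Finset.card_range]
    exact Nat.mul_le_mul_right _ (hm a).le
  obtain ⟨F, hFA, hF, P, hP⟩ := exists_same_nbrs (c.labelGraph a) hZ hA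
  obtain ⟨Y', hY'W, hY', hpop⟩ := exists_subset_card_le_mul_card_nbrs (c.labelGraph a) hk
    fun x hx ↦ hadj x (hFA hx)
  rw [hF] at hpop
  refine ⟨Function.update m a (m a + 1), Function.update X a (Function.update (X a) (m a) F), Y',
    fun b ↦ ?_, ?_, by nlinarith⟩
  · rcases eq_or_ne b a with rfl | hb
    · simpa using (h b).snoc hD₁ (hY'W.trans hWY) hF (hFA.trans hAY) hP hpop
    · simpa [hb] using (h b).mono (hY'W.trans hWY)
  · refine Finset.sum_lt_sum (fun b _ ↦ ?_) ⟨a, Finset.mem_univ _, ?_⟩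
    · rcases eq_or_ne b a with rfl | hb
      · simp only [Function.update_self]
        omega
      · simp [hb]
    · have := hm a
      simp only [Function.update_self]
      omega

theorem card_lt_of_isTower [DecidableEq V] {ℓ k r t D : ℕ} (hk : 1 ≤ k) (hℓ : 1 ≤ ℓ)
    (hD₁ : 1 ≤ D) (hD : 4 * k * (2 ^ towerLength k r * t) ≤ D)
    (c : TopEdgeLabeling V (Fin ℓ)) (hc : IsKGallai k c)
    (hno : ∀ a U, ¬ HasParts (c.labelGraph a) r t U) (s : ℕ) :
    ∀ (m : Fin ℓ → ℕ) (X : Fin ℓ → ℕ → Finset V) (Y : Finset V),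
      (∀ a, IsTower (c.labelGraph a) k D (m a) (X a) Y) →
      ∑ a, (towerLength k r - m a) ≤ s →
      Y.card < 3 * (ℓ * (2 ^ (towerLength k r * D) * D)) * (6 * k) ^ s := by
  induction s with
  | zero =>
    intro m X Y h hs
    by_contra! hY
    obtain ⟨m', X', Y', -, h2, -⟩ :=
      exists_tower_extension hk hℓ hD₁ hD c hc hno h (by simpa using hY)
    omega
  | succ s ih =>
    intro m X Y h hs
    by_contra! hY
    obtain ⟨m', X', Y', h1, h2, h3⟩ := exists_tower_extension hk hℓ hD₁ hD c hc hno h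
      ((Nat.le_mul_of_pos_right _ (by positivity)).trans hY)
    have h4 := ih m' X' Y' h1 (by omega)
    have h5 := Nat.mul_lt_mul_of_pos_left h4 (by omega : 0 < 6 * k)
    rw [pow_succ] at hY
    nlinarith

theorem exists_hasParts [DecidableEq V] [Fintype V] {ℓ k r t D : ℕ} (hk : 1 ≤ k) (hℓ : 1 ≤ ℓ)
    (hD₁ : 1 ≤ D) (hD : 4 * k * (2 ^ towerLength k r * t) ≤ D)
    (c : TopEdgeLabeling V (Fin ℓ)) (hc : IsKGallai k c)
    (hV : 3 * (ℓ * (2 ^ (towerLength k r * D) * D)) * (6 * k) ^ (ℓ * towerLength k r) ≤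
      Fintype.card V) : ∃ a U, HasParts (c.labelGraph a) r t U := by
  by_contra! hno
  refine absurd hV (not_le.2 ?_)
  rw [← Finset.card_univ]
  refine card_lt_of_isTower hk hℓ hD₁ hD c hc hno _ (fun _ ↦ 0) (fun _ _ ↦ ∅) _ (fun a ↦ ?_)
    (by simp)
  exact ⟨by simp, by simp, by simp⟩

variable {W : Type*} [Finite W] {H : SimpleGraph W}

theorem exists_forces_linear (hH : H.Colorable 2) {k : ℕ} (hk : 1 ≤ k) :
    ∃ A : ℕ, ∀ ℓ, 1 ≤ ℓ → Forces k ℓ H (A * ℓ) := by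
  -- The `+ 1` keeps the part size positive when `W` is empty.
  refine ⟨6 * k * (2 ^ (2 * k * (Nat.card W + 1)) * (2 * k * (Nat.card W + 1))),
    fun ℓ hℓ n hn c hc ↦ ?_⟩
  obtain ⟨a, U, h⟩ := exists_hasParts_two (t := Nat.card W + 1) hk hℓ (by omega) c hc
    (by rwa [Fintype.card_fin])
  exact ⟨a, h.isContained hH (by omega)⟩

theorem exists_forces_exponential {r : ℕ} (hH : H.Colorable r) {k : ℕ} (hk : 1 ≤ k) :
    ∃ A : ℕ, ∀ ℓ, 1 ≤ ℓ → Forces k ℓ H (A * (2 * (6 * k) ^ towerLength k r) ^ ℓ) := by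
  obtain ⟨D, hD⟩ : ∃ D, D = 4 * k * (2 ^ towerLength k r * Nat.card W) + 1 := ⟨_, rfl⟩
  refine ⟨3 * (2 ^ (towerLength k r * D) * D), fun ℓ hℓ n hn c hc ↦ ?_⟩
  obtain ⟨a, U, h⟩ := exists_hasParts (r := r) (t := Nat.card W) (D := D) hk hℓ (by omega)
    (by omega) c hc (by
      rw [Fintype.card_fin]
      refine le_trans ?_ hn
      -- The linear factor `ℓ` is absorbed here, whence the 2 in the base.
      have h1 : ℓ ≤ 2 ^ ℓ := Nat.lt_two_pow_self.le
      calc _ = 3 * (2 ^ (towerLength k r * D) * D) * (6 * k) ^ (ℓ * towerLength k r) * ℓ := by ring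
        _ ≤ 3 * (2 ^ (towerLength k r * D) * D) * (6 * k) ^ (ℓ * towerLength k r) * 2 ^ ℓ :=
          Nat.mul_le_mul_left _ h1
        _ = _ := by rw [mul_pow 2, ← pow_mul, mul_comm ℓ, mul_assoc, mul_comm (2 ^ ℓ)])
  exact ⟨a, h.isContained hH le_rfl⟩

end UpperBounds

end GallaiRamsey

theorem mainTheorem1 :
    ∃ B : ℕ → ℕ → ℝ, ∀ (V : Type*) [Finite V] (H : SimpleGraph V),
      -- the numbers are well defined
      (∀ k ℓ : ℕ, 1 ≤ k → 1 ≤ ℓ → ∃ N, GallaiRamsey.Forces k ℓ H N) ∧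
      -- linear growth
      (H.IsBipartite → ¬ GallaiRamsey.IsStar H →
        ∃ a : ℝ, 0 < a ∧ ∀ k : ℕ, 1 ≤ k → ∃ A : ℝ, ∀ ℓ : ℕ, 1 ≤ ℓ →
          a * ℓ ≤ GallaiRamsey.ggr k ℓ H ∧ (GallaiRamsey.ggr k ℓ H : ℝ) ≤ A * ℓ) ∧
      -- exponential growth, the base being controlled from both sides by the chromatic number
      (¬ H.IsBipartite → ∀ χ : ℕ, H.chromaticNumber = χ →
        ∀ k : ℕ, 1 ≤ k → ∃ A : ℝ, ∀ ℓ : ℕ, 1 ≤ ℓ →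
          ((χ : ℝ) - 1) ^ ℓ < GallaiRamsey.ggr k ℓ H ∧
          (GallaiRamsey.ggr k ℓ H : ℝ) ≤ A * B k χ ^ ℓ) := by
  refine ⟨fun k χ ↦ 2 * (6 * k) ^ GallaiRamsey.towerLength k χ, fun V _ H ↦ ?_⟩
  have hex : ∀ k ℓ : ℕ, 1 ≤ k → 1 ≤ ℓ → ∃ N, GallaiRamsey.Forces k ℓ H N := by
    intro k ℓ hk hℓ
    have := Fintype.ofFinite V
    obtain ⟨A, hA⟩ := GallaiRamsey.exists_forces_exponential H.colorable_of_fintype hk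
    exact ⟨_, hA ℓ hℓ⟩
  refine ⟨hex, fun hbip hstar ↦ ⟨1, one_pos, fun k hk ↦ ?_⟩, fun hbip χ hχ k hk ↦ ?_⟩
  · obtain ⟨A, hA⟩ := GallaiRamsey.exists_forces_linear hbip hk
    refine ⟨A, fun ℓ hℓ ↦ ⟨?_, ?_⟩⟩
    · rw [one_mul]
      exact_mod_cast (GallaiRamsey.lt_ggr_of_not_isStar hk hstar (hex k ℓ hk hℓ)).le
    · have : GallaiRamsey.ggr k ℓ H ≤ _ := Nat.sInf_le (hA ℓ hℓ)
      exact_mod_cast this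
  · have hcol : H.Colorable χ := SimpleGraph.chromaticNumber_le_iff_colorable.1 hχ.le
    -- This makes the natural number `χ - 1` agree with the real one in the bound.
    have hχ1 : 1 ≤ χ := by
      by_contra! h
      obtain rfl : χ = 0 := by omega
      exact hbip (hcol.mono (by omega))
    have hncol : ¬ H.Colorable (χ - 1) := by
      intro h
      have := SimpleGraph.chromaticNumber_le_iff_colorable.2 h
      rw [hχ, Nat.cast_le] at this
      omega
    obtain ⟨A, hA⟩ := GallaiRamsey.exists_forces_exponential hcol hk
    refine ⟨A, fun ℓ hℓ ↦ ⟨?_, ?_⟩⟩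
    · have := GallaiRamsey.pow_lt_ggr hk hncol (hex k ℓ hk hℓ)
      rw [← Nat.cast_pred hχ1]
      exact_mod_cast this
    · have : GallaiRamsey.ggr k ℓ H ≤ _ := Nat.sInf_le (hA ℓ hℓ)
      beta_reduce
      exact_mod_cast this
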